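/- All graphs are finite, simple, undirected and connected. For a vertex $x$ let $N[x]$ denote its closed neighborhood; a graph is *thin* if $N[x]=N[y]$ implies $x=y$. The strong product $\boxtimes_{l=1}^n G_l$ has vertex set $\prod_l V(G_l)$, two distinct vertices $x,y$ being adjacent if for each $l$ either $x_l=y_l$ or $x_ly_l\in E(G_l)$; an edge of it is *Cartesian* if its endpoints differ in exactly one coordinate, and *non-Cartesian* otherwise. A graph is *prime* if it is not isomorphic to a strong product of two graphs with at least two vertices each. A *subproduct* of $\boxtimes_l G_l$ is a strong product $\boxtimes_l A_l$ of subgraphs $A_l\subseteq G_l$. For a set $J$ of coordinates, the layer of $\boxtimes_{l\in J}G_l$ through a vertex $u$ is the subgraph induced by the vertices that agree with $u$ in all coordinates outside $J$; it is isomorphic to $\boxtimes_{l\in J}G_l$. **Lemma.** Let $G=\boxtimes_{l=1}^n G_l$ be a thin graph with all $G_l$ prime. Let $H\subseteq G$ be a thin subproduct of $G$, with prime factorization $H\cong\boxtimes_{i=1}^m H_i$ (all $H_i$ prime), which gives the vertices of $H$ their coordinates in $H$. Suppose that some edge $(v,w)\in E(H)$ is non-Cartesian in $H$ (with respect to the coordinates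 in $H$) but Cartesian in $G$. Let $J$ be the set of indices $i\in\{1,\dots,m\}$ for which $v$ and $w$ have different $i$-th coordinates in $H$. Then the factor $\boxtimes_{i\in J}H_i$ of $H$ is a subgraph of a single prime factor of $G$: there is an index $l\in\{1,\dots,n\}$ such that $\boxtimes_{i\in J}H_i$ is isomorphic to a subgraph of $G_l$ and, for every vertex $u$ of $H$, the layer of $\boxtimes_{i\in J}H_i$ through $u$ in $H$ is a subgraph of the $G_l$-layer through $u$ in $G$. -/

import Mathlib

namespace StrongProduct

universe u v

/-- The closed `1`-neighborhood `N[x]`. -/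
def closedNeighborSet {V : Type*} (G : SimpleGraph V) (x : V) : Set V :=
  {z | z = x ∨ G.Adj x z}

/-- A graph is (S-)thin if distinct vertices have distinct closed neighborhoods. -/
def IsThin {V : Type*} (G : SimpleGraph V) : Prop :=
  ∀ x y : V, closedNeighborSet G x = closedNeighborSet G y → x = y

/-- The strong product of two graphs. -/
def strongProd {α β : Type*} (A : SimpleGraph α) (B : SimpleGraph β) : SimpleGraph (α × β) where
  Adj x y :=
    (A.Adj x.1 y.1 ∧ x.2 = y.2) ∨ (B.Adj x.2 y.2 ∧ x.1 = y.1) ∨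
      (A.Adj x.1 y.1 ∧ B.Adj x.2 y.2)
  symm := ⟨fun x y h => by
    rcases h with h | h | h
    · exact Or.inl ⟨h.1.symm, h.2.symm⟩
    · exact Or.inr (Or.inl ⟨h.1.symm, h.2.symm⟩)
    · exact Or.inr (Or.inr ⟨h.1.symm, h.2.symm⟩)⟩
  loopless := ⟨fun x h => by
    rcases h with h | h | h
    · exact h.1.ne rfl
    · exact h.1.ne rfl
    · exact h.1.ne rfl⟩

/-- The strong product of a family of graphs, with vertices given by their coordinate vectors:
distinct vertices are adjacent if in every coordinate they are equal or adjacent. -/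
def strongPi {ι : Type*} {V : ι → Type*} (G : ∀ i, SimpleGraph (V i)) :
    SimpleGraph (∀ i, V i) where
  Adj x y := x ≠ y ∧ ∀ i, x i = y i ∨ (G i).Adj (x i) (y i)
  symm := ⟨fun _ _ h => ⟨h.1.symm, fun i => (h.2 i).imp Eq.symm fun e => e.symm⟩⟩
  loopless := ⟨fun _ h => h.1 rfl⟩

/-- A graph is the one-vertex graph `K₁`, up to isomorphism. -/
def IsK1 {V : Type*} (G : SimpleGraph V) : Prop :=
  Nonempty (G ≃g (⊤ : SimpleGraph (Fin 1)))

/-- A graph is prime with respect to the strong product if, whenever it is a strong product of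
two graphs, one of them is `K₁`. -/
def IsPrime {V : Type u} (G : SimpleGraph V) : Prop :=
  ∀ (α β : Type u) (A : SimpleGraph α) (B : SimpleGraph β),
    Nonempty (G ≃g strongProd A B) → IsK1 A ∨ IsK1 B

/-- An edge of the strong product of the family `G` is Cartesian if its endpoints differ in exactly
one coordinate. -/
def IsCartesianEdge {ι : Type*} {V : ι → Type*} (G : ∀ i, SimpleGraph (V i))
    (x y : ∀ i, V i) : Prop :=
  (strongPi G).Adj x y ∧ ∃! i, x i ≠ y i

/-- The strong product of subgraphs `A i` of the factors `G i`, as a subgraph of the strong product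
of the `G i`. -/
def subproduct {ι : Type*} {V : ι → Type*} {G : ∀ i, SimpleGraph (V i)}
    (A : ∀ i, (G i).Subgraph) : (strongPi G).Subgraph where
  verts := {x | ∀ i, x i ∈ (A i).verts}
  Adj x y := x ≠ y ∧ ∀ i, (x i = y i ∧ x i ∈ (A i).verts) ∨ (A i).Adj (x i) (y i)
  adj_sub := fun h => ⟨h.1, fun i => (h.2 i).imp And.left fun e => e.adj_sub⟩
  edge_vert := fun h i => (h.2 i).elim And.right fun e => e.fst_mem
  symm := ⟨fun _ _ h => ⟨h.1.symm, fun i =>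
    (h.2 i).imp (fun e => ⟨Eq.symm (And.left e), (And.left e) ▸ (And.right e)⟩) fun e => e.symm⟩⟩

/-- A subproduct of a strong product: a strong product of subgraphs of the factors. -/
def IsSubproduct {ι : Type*} {V : ι → Type*} {G : ∀ i, SimpleGraph (V i)}
    (H : (strongPi G).Subgraph) : Prop :=
  ∃ A : ∀ i, (G i).Subgraph, H = subproduct A

/-- The layer through the vertex `x` of the factor formed by the coordinates in `J`: the subgraph
induced by the vertices that agree with `x` in every coordinate outside `J`. For `J = {l}` this is
the `G l`-layer through `x`. -/
def layer {ι : Type*} {V : ι → Type*} (G : ∀ i, SimpleGraph (V i)) (J : Set ι) (x : ∀ i, V i) :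
    (strongPi G).Subgraph :=
  (⊤ : (strongPi G).Subgraph).induce {y | ∀ i, i ∉ J → y i = x i}

end StrongProduct

/-! Give an edge or loop $xy$ the cost $\log|N[x]|+\log|N[y]|-2\log|N[x]\cap N[y]|$. Closed
neighborhoods in a strong product are products, so costs, and with them cheapest-chain distances
$d$, add over the factors (`chainDist_prod`); in a finite connected thin graph $d$ separates points.
Hence all factorizations of $H$ split one and the same distance as a sum.

Compare the factorization of $H$ that splits off the ambient coordinate $l$ in which $v,w$ differ
with one that splits off a prime factor. If $z$ mixes the ambient coordinates of $p$ and $q$, then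
$d(p,z)+d(z,q)=d(p,q)$, so $z$ cannot leave a layer containing $p$ and $q$ (`layer_box`). A prime
layer is therefore the strong product of its two sections; one is trivial, so the layers of that
factor are all constant in coordinate $l$ or all constant in the others (`layer_constant_of_prime`).
If $v,w$ differ in this factor, `eq_of_layer_constant` excludes the first case. Changing the
coordinates in $J$ one by one thus moves only coordinate $l$, and projection to it embeds each
$J$-layer in $G_l$. -/

namespace StrongProduct

universe u

/-! ### The chain distance of a reflexive relation. -/

section Metric

variable {X A B : Type*}

/-- The set of successors of `x` under a relation. -/
def relNbhd (R : X → X → Prop) (x : X) : Set X := {z | R x z}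

/-- A cost that measures how much the neighborhoods of two points differ. It is additive with
respect to products of relations. -/
noncomputable def overlapCost (R : X → X → Prop) (x y : X) : ℝ :=
  Real.log (relNbhd R x).ncard + Real.log (relNbhd R y).ncard
    - 2 * Real.log (relNbhd R x ∩ relNbhd R y).ncard

/-- `HasChain R x y r`: there is an `R`-chain from `x` to `y` of total cost `r`. -/
inductive HasChain (R : X → X → Prop) : X → X → ℝ → Prop
  | nil (x : X) : HasChain R x x 0
  | cons {x y z : X} {r : ℝ} (h : R x y) (c : HasChain R y z r) :
      HasChain R x z (overlapCost R x y + r)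

/-- The infimum of the costs of chains between two points. -/
noncomputable def chainDist (R : X → X → Prop) (x y : X) : ℝ := sInf {r | HasChain R x y r}

/-- Any two points are joined by a chain. -/
def ChainConnected (R : X → X → Prop) : Prop := ∀ x y, ∃ r, HasChain R x y r

theorem overlapCost_self (R : X → X → Prop) (x : X) : overlapCost R x x = 0 := by
  simp only [overlapCost, Set.inter_self]; ring

theorem mem_relNbhd_inter {R : X → X → Prop} (hr : ∀ x, R x x) {x y : X} (h : R x y) :
    y ∈ relNbhd R x ∩ relNbhd R y := ⟨h, hr y⟩

theorem HasChain.trans {R : X → X → Prop} {x y z : X} {r s : ℝ} (c : HasChain R x y r) (c' : HasChain R y z s) :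
    HasChain R x z (r + s) := by
  induction c with
  | nil => simpa using c'
  | cons h _ ih => rw [add_assoc]; exact .cons h (ih c')

theorem exists_hasChain_lt {R : X → X → Prop} (hc : ChainConnected R) (x y : X) {ε : ℝ}
    (hε : 0 < ε) : ∃ r, HasChain R x y r ∧ r < chainDist R x y + ε :=
  exists_lt_of_csInf_lt (hc x y) (lt_add_of_pos_right _ hε)

section Finite

variable [Finite X] {R : X → X → Prop}

theorem ncard_relNbhd_inter_pos (hr : ∀ x, R x x) {x y : X} (h : R x y) :
    0 < (relNbhd R x ∩ relNbhd R y).ncard :=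
  (Set.ncard_pos (Set.toFinite _)).2 ⟨y, mem_relNbhd_inter hr h⟩

theorem ncard_relNbhd_pos (hr : ∀ x, R x x) (x : X) : 0 < (relNbhd R x).ncard :=
  (Set.ncard_pos (Set.toFinite _)).2 ⟨x, hr x⟩

theorem log_ncard_inter_le {x y : X} (hr : ∀ x, R x x) (h : R x y) :
    Real.log (relNbhd R x ∩ relNbhd R y).ncard ≤ Real.log (relNbhd R x).ncard ∧
    Real.log (relNbhd R x ∩ relNbhd R y).ncard ≤ Real.log (relNbhd R y).ncard := by
  have h0 : (0 : ℝ) < ((relNbhd R x ∩ relNbhd R y).ncard : ℝ) := by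
    exact_mod_cast ncard_relNbhd_inter_pos hr h
  constructor <;> refine Real.log_le_log h0 ?_ <;> norm_cast <;>
    refine Set.ncard_le_ncard ?_ (Set.toFinite _)
  exacts [Set.inter_subset_left, Set.inter_subset_right]

theorem overlapCost_nonneg (hr : ∀ x, R x x) {x y : X} (h : R x y) : 0 ≤ overlapCost R x y := by
  have := log_ncard_inter_le hr h
  unfold overlapCost
  linarith

/-- Cost zero would make the intersection as large as both neighborhoods, so these would coincide.
-/
theorem overlapCost_pos (hr : ∀ x, R x x)
    (ht : ∀ x y, relNbhd R x = relNbhd R y → x = y) {x y : X} (h : R x y) (hxy : x ≠ y) :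
    0 < overlapCost R x y := by
  refine lt_of_le_of_ne (overlapCost_nonneg hr h) fun h0 => hxy (ht x y ?_)
  obtain ⟨h1, h2⟩ := log_ncard_inter_le hr h
  unfold overlapCost at h0
  have key : ∀ z, Real.log (relNbhd R x ∩ relNbhd R y).ncard = Real.log (relNbhd R z).ncard →
      (relNbhd R z).ncard ≤ (relNbhd R x ∩ relNbhd R y).ncard := fun z hz => by
    have := Real.log_injOn_pos (Set.mem_Ioi.2 (Nat.cast_pos.2 (ncard_relNbhd_inter_pos hr h)))
      (Set.mem_Ioi.2 (Nat.cast_pos.2 (ncard_relNbhd_pos hr z))) hz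
    exact (Nat.cast_injective this).ge
  have e1 := Set.eq_of_subset_of_ncard_le Set.inter_subset_left (key x (by linarith))
    (Set.toFinite _)
  have e2 := Set.eq_of_subset_of_ncard_le Set.inter_subset_right (key y (by linarith))
    (Set.toFinite _)
  exact e1.symm.trans e2

theorem HasChain.nonneg (hr : ∀ x, R x x) {x y : X} {r : ℝ} (c : HasChain R x y r) : 0 ≤ r := by
  induction c with
  | nil => exact le_rfl
  | cons h _ ih => exact add_nonneg (overlapCost_nonneg hr h) ih

theorem bddBelow_hasChain (hr : ∀ x, R x x) (x y : X) : BddBelow {r | HasChain R x y r} :=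
  ⟨0, fun _ c => HasChain.nonneg hr c⟩

theorem chainDist_le (hr : ∀ x, R x x) {x y : X} {r : ℝ} (c : HasChain R x y r) :
    chainDist R x y ≤ r := csInf_le (bddBelow_hasChain hr x y) c

theorem chainDist_nonneg (hr : ∀ x, R x x) (x y : X) : 0 ≤ chainDist R x y :=
  Real.sInf_nonneg fun _ c => HasChain.nonneg hr c

theorem chainDist_self (hr : ∀ x, R x x) (x : X) : chainDist R x x = 0 :=
  le_antisymm (chainDist_le hr (.nil x)) (chainDist_nonneg hr x x)

theorem chainDist_triangle (hr : ∀ x, R x x) (hc : ChainConnected R) (x y z : X) :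
    chainDist R x z ≤ chainDist R x y + chainDist R y z := by
  refine le_of_forall_pos_le_add fun ε hε => ?_
  obtain ⟨r, cr, hr'⟩ := exists_hasChain_lt hc x y (half_pos hε)
  obtain ⟨s, cs, hs'⟩ := exists_hasChain_lt hc y z (half_pos hε)
  have := chainDist_le hr (HasChain.trans cr cs)
  linarith

theorem eq_of_chainDist_eq_zero (hr : ∀ x, R x x)
    (ht : ∀ x y, relNbhd R x = relNbhd R y → x = y) (hc : ChainConnected R) {x y : X}
    (h : chainDist R x y = 0) : x = y := by
  by_contra hne
  -- Finiteness bounds the costs of nontrivial steps away from zero, so the infimum over chains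
  -- stays positive.
  obtain ⟨ε, hε, hmin⟩ : ∃ ε > 0, ∀ x y, R x y → x ≠ y → ε ≤ overlapCost R x y := by
    let S : Set (X × X) := {p | R p.1 p.2 ∧ p.1 ≠ p.2}
    rcases S.eq_empty_or_nonempty with hS | hS
    · refine ⟨1, one_pos, fun x y h1 h2 => ?_⟩
      have : (x, y) ∈ S := ⟨h1, h2⟩
      simp [hS] at this
    · obtain ⟨p, hp, hpm⟩ := Set.exists_min_image S (fun p => overlapCost R p.1 p.2)
        (Set.toFinite _) hS
      exact ⟨_, overlapCost_pos hr ht hp.1 hp.2, fun x y h1 h2 => hpm (x, y) ⟨h1, h2⟩⟩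
  have key : ∀ {x y : X} {r : ℝ}, HasChain R x y r → x ≠ y → ε ≤ r := fun c => by
    induction c with
    | nil => exact fun h => absurd rfl h
    | @cons x y z r h c ih =>
      intro hxz
      by_cases hxy : x = y
      · subst hxy
        have := ih hxz
        rwa [overlapCost_self, zero_add]
      · have := hmin x y h hxy
        have := HasChain.nonneg hr c
        linarith
  have : ε ≤ chainDist R x y := le_csInf (hc x y) fun r c => key c hne
  linarith

end Finite

/-! ### Additivity of the distance over a factorization. -/

section Product

/-- A factorization of a relation `R` as the product of two reflexive relations. -/
structure RelFactorization (R : X → X → Prop) (RA : A → A → Prop) (RB : B → B → Prop) where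
  /-- The coordinates. -/
  equiv : X ≃ A × B
  refl_left : ∀ a, RA a a
  refl_right : ∀ b, RB b b
  rel_iff : ∀ x y, R x y ↔ RA (equiv x).1 (equiv y).1 ∧ RB (equiv x).2 (equiv y).2

theorem ncard_preimage_prod (e : X ≃ A × B) (s : Set A) (t : Set B) :
    (e ⁻¹' (s ×ˢ t)).ncard = s.ncard * t.ncard := by
  rw [← Equiv.image_symm_eq_preimage, Set.ncard_image_of_injective _ e.symm.injective,
    Set.ncard_prod]

variable {R : X → X → Prop} {RA : A → A → Prop} {RB : B → B → Prop}

namespace RelFactorization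

variable (e : RelFactorization R RA RB)

/-- Interchange of the two factors. -/
def swap : RelFactorization R RB RA where
  equiv := e.equiv.trans (Equiv.prodComm A B)
  refl_left := e.refl_right
  refl_right := e.refl_left
  rel_iff x y := (e.rel_iff x y).trans and_comm

theorem refl (e : RelFactorization R RA RB) (x : X) : R x x :=
  (e.rel_iff x x).2 ⟨e.refl_left _, e.refl_right _⟩

theorem relNbhd_eq_preimage_prod (x : X) :
    relNbhd R x = e.equiv ⁻¹' (relNbhd RA (e.equiv x).1 ×ˢ relNbhd RB (e.equiv x).2) := by
  ext z; exact e.rel_iff x z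

variable [Finite A] [Finite B]

/-- The logarithm turns products of cardinalities into sums; `hxy` keeps the intersections nonempty.
-/
theorem overlapCost_prod {x y : X} (hxy : R x y) :
    overlapCost R x y =
      overlapCost RA (e.equiv x).1 (e.equiv y).1 + overlapCost RB (e.equiv x).2 (e.equiv y).2 := by
  obtain ⟨h1, h2⟩ := (e.rel_iff x y).1 hxy
  have n1 : ∀ a, ((relNbhd RA a).ncard : ℝ) ≠ 0 := fun a =>
    Nat.cast_ne_zero.2 (ncard_relNbhd_pos e.refl_left a).ne'
  have n2 : ∀ a, ((relNbhd RB a).ncard : ℝ) ≠ 0 := fun a =>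
    Nat.cast_ne_zero.2 (ncard_relNbhd_pos e.refl_right a).ne'
  have n3 := Nat.cast_ne_zero (R := ℝ).2 (ncard_relNbhd_inter_pos e.refl_left h1).ne'
  have n4 := Nat.cast_ne_zero (R := ℝ).2 (ncard_relNbhd_inter_pos e.refl_right h2).ne'
  unfold overlapCost
  rw [e.relNbhd_eq_preimage_prod x, e.relNbhd_eq_preimage_prod y, ← Set.preimage_inter,
    Set.prod_inter_prod]
  simp only [ncard_preimage_prod, Nat.cast_mul]
  rw [Real.log_mul (n1 _) (n2 _), Real.log_mul (n1 _) (n2 _), Real.log_mul n3 n4]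
  ring

theorem split_chain {x y : X} {r : ℝ} (c : HasChain R x y r) :
    ∃ s t, HasChain RA (e.equiv x).1 (e.equiv y).1 s ∧
      HasChain RB (e.equiv x).2 (e.equiv y).2 t ∧ r = s + t := by
  induction c with
  | nil x => exact ⟨0, 0, .nil _, .nil _, by simp⟩
  | cons hxy _ ih =>
    obtain ⟨s, t, cs, ct, rfl⟩ := ih
    refine ⟨_, _, .cons ((e.rel_iff _ _).1 hxy).1 cs, .cons ((e.rel_iff _ _).1 hxy).2 ct, ?_⟩
    rw [e.overlapCost_prod hxy]
    ring

theorem lift_chain_left {a a' : A} {r : ℝ} (c : HasChain RA a a' r) (b : B) :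
    HasChain R (e.equiv.symm (a, b)) (e.equiv.symm (a', b)) r := by
  induction c with
  | nil => exact .nil _
  | @cons a a' a'' r haa' _ ih =>
    have hR : R (e.equiv.symm (a, b)) (e.equiv.symm (a', b)) :=
      (e.rel_iff _ _).2 (by simpa using ⟨haa', e.refl_right b⟩)
    have := HasChain.cons hR ih
    rw [e.overlapCost_prod hR] at this
    simpa [overlapCost_self] using this

theorem lift_chain_right {b b' : B} {r : ℝ} (c : HasChain RB b b' r) (a : A) :
    HasChain R (e.equiv.symm (a, b)) (e.equiv.symm (a, b')) r := by
  induction c with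
  | nil => exact .nil _
  | @cons b b' b'' r hbb' _ ih =>
    have hR : R (e.equiv.symm (a, b)) (e.equiv.symm (a, b')) :=
      (e.rel_iff _ _).2 (by simpa using ⟨e.refl_left a, hbb'⟩)
    have := HasChain.cons hR ih
    rw [e.overlapCost_prod hR] at this
    simpa [overlapCost_self] using this

include e

theorem chainConnected_left [Nonempty B] (hc : ChainConnected R) : ChainConnected RA :=
  fun a a' => by
    obtain ⟨b⟩ := ‹Nonempty B›
    obtain ⟨r, c⟩ := hc (e.equiv.symm (a, b)) (e.equiv.symm (a', b))
    obtain ⟨s, t, cs, -, -⟩ := e.split_chain c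
    exact ⟨s, by simpa using cs⟩

theorem chainConnected_right [Nonempty A] (hc : ChainConnected R) : ChainConnected RB :=
  fun b b' => by
    obtain ⟨a⟩ := ‹Nonempty A›
    obtain ⟨r, c⟩ := hc (e.equiv.symm (a, b)) (e.equiv.symm (a, b'))
    obtain ⟨s, t, -, ct, -⟩ := e.split_chain c
    exact ⟨t, by simpa using ct⟩

theorem chainDist_prod [Finite X] (hc : ChainConnected R) (x y : X) :
    chainDist R x y =
      chainDist RA (e.equiv x).1 (e.equiv y).1 + chainDist RB (e.equiv x).2 (e.equiv y).2 := by
  have : Nonempty A := ⟨(e.equiv x).1⟩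
  have : Nonempty B := ⟨(e.equiv x).2⟩
  have cA := e.chainConnected_left hc
  have cB := e.chainConnected_right hc
  apply le_antisymm
  · refine le_of_forall_pos_le_add fun ε hε => ?_
    obtain ⟨r, cr, hr'⟩ := exists_hasChain_lt cA (e.equiv x).1 (e.equiv y).1 (half_pos hε)
    obtain ⟨s, cs, hs'⟩ := exists_hasChain_lt cB (e.equiv x).2 (e.equiv y).2 (half_pos hε)
    -- Move in one factor while the other stands still, then exchange roles; loops cost nothing.
    have c := HasChain.trans (e.lift_chain_left cr (e.equiv x).2)
      (e.lift_chain_right cs (e.equiv y).1)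
    simp only [Prod.mk.eta, Equiv.symm_apply_apply] at c
    have := chainDist_le e.refl c
    linarith
  · refine le_csInf (hc x y) fun r c => ?_
    obtain ⟨s, t, cs, ct, rfl⟩ := e.split_chain c
    exact add_le_add (chainDist_le e.refl_left cs) (chainDist_le e.refl_right ct)

end RelFactorization

end Product

end Metric

/-- The reflexive closure of adjacency. -/
def reflAdj {V : Type*} (G : SimpleGraph V) (x y : V) : Prop := x = y ∨ G.Adj x y

theorem adj_iff_reflAdj {V : Type*} {G : SimpleGraph V} {x y : V} :
    G.Adj x y ↔ x ≠ y ∧ reflAdj G x y :=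
  ⟨fun h => ⟨h.ne, Or.inr h⟩, fun h => h.2.resolve_left h.1⟩

theorem strongProd_adj_iff {α β : Type*} {A : SimpleGraph α} {B : SimpleGraph β} {x y : α × β} :
    (strongProd A B).Adj x y ↔ x ≠ y ∧ reflAdj A x.1 y.1 ∧ reflAdj B x.2 y.2 := by
  obtain ⟨a, b⟩ := x
  obtain ⟨a', b'⟩ := y
  have h1 : A.Adj a a' → a ≠ a' := SimpleGraph.Adj.ne
  have h2 : B.Adj b b' → b ≠ b' := SimpleGraph.Adj.ne
  simp only [strongProd, reflAdj, ne_eq, Prod.mk.injEq]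
  tauto

theorem IsK1.subsingleton {V : Type*} {G : SimpleGraph V} (h : IsK1 G) : Subsingleton V :=
  h.some.toEquiv.subsingleton

namespace RelFactorization

/-! ### Metric comparison of two factorizations. -/

section Box

variable {X A B C D : Type*} {R : X → X → Prop} {RA : A → A → Prop} {RB : B → B → Prop}
  {RC : C → C → Prop} {RD : D → D → Prop} [Finite X] [Finite A] [Finite B] [Finite C] [Finite D]
  (e : RelFactorization R RA RB) (f : RelFactorization R RC RD)
  (ht : ∀ x y, relNbhd R x = relNbhd R y → x = y) (hc : ChainConnected R)

include ht hc

/-- Lifting to a layer of `X` reduces this to thinness of the whole relation, so the factors need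
not be assumed thin. -/
theorem eq_of_chainDist_right_eq_zero {p z : X}
    (h0 : chainDist RD (f.equiv p).2 (f.equiv z).2 = 0) : (f.equiv p).2 = (f.equiv z).2 := by
  have g := f.chainDist_prod hc p (f.equiv.symm ((f.equiv p).1, (f.equiv z).2))
  simp only [Equiv.apply_symm_apply, chainDist_self f.refl_left, h0, add_zero] at g
  have := eq_of_chainDist_eq_zero f.refl ht hc g
  simpa using congrArg (fun x => (f.equiv x).2) this

/-- Layers of one factorization are boxes with respect to any other one. -/
theorem layer_box {p q z : X} (hpq : (f.equiv p).2 = (f.equiv q).2)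
    (h1 : (e.equiv z).1 = (e.equiv p).1) (h2 : (e.equiv z).2 = (e.equiv q).2) :
    (f.equiv z).2 = (f.equiv p).2 := by
  have : Nonempty D := ⟨(f.equiv p).2⟩
  have cC := f.chainConnected_left hc
  have e1 := e.chainDist_prod hc p z
  have e2 := e.chainDist_prod hc z q
  have e3 := e.chainDist_prod hc p q
  have f1 := f.chainDist_prod hc p z
  have f2 := f.chainDist_prod hc z q
  have f3 := f.chainDist_prod hc p q
  rw [h1, chainDist_self e.refl_left, h2] at e1
  rw [h1, h2, chainDist_self e.refl_right] at e2
  rw [hpq, chainDist_self f.refl_right] at f3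
  -- Since $d(p,z)+d(z,q)=d(p,q)=d_C(p,q)$, the triangle inequality in $C$ leaves no room for a
  -- $D$-part.
  have t := chainDist_triangle f.refl_left cC (f.equiv p).1 (f.equiv z).1 (f.equiv q).1
  have n1 := chainDist_nonneg f.refl_right (f.equiv p).2 (f.equiv z).2
  have n2 := chainDist_nonneg f.refl_right (f.equiv z).2 (f.equiv q).2
  exact (f.eq_of_chainDist_right_eq_zero ht hc (by linarith)).symm

/-- If a single layer is constant in the second factor of another factorization, then so are all
parallel layers. -/
theorem layer_constant_of_layer_constant {d : D}
    (h : ∀ x y, (f.equiv x).2 = d → (f.equiv y).2 = d → (e.equiv x).2 = (e.equiv y).2) {x y : X}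
    (hxy : (f.equiv x).2 = (f.equiv y).2) : (e.equiv x).2 = (e.equiv y).2 := by
  -- The points $p,q$ are the copies of $x,y$ in layer $d$. The corners $z,w$ keep the
  -- $C$-coordinates of $x,y$, so $d_A(x,y)+d_B(x,y)=d_C(x,y)\le d(z,w)=d_A(x,y)$.
  obtain ⟨p, hp⟩ : ∃ p, f.equiv p = ((f.equiv x).1, d) := f.equiv.surjective _
  obtain ⟨q, hq⟩ : ∃ q, f.equiv q = ((f.equiv y).1, d) := f.equiv.surjective _
  obtain ⟨z, hz⟩ : ∃ z, e.equiv z = ((e.equiv x).1, (e.equiv p).2) := e.equiv.surjective _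
  obtain ⟨w, hw⟩ : ∃ w, e.equiv w = ((e.equiv y).1, (e.equiv q).2) := e.equiv.surjective _
  have hpq : (e.equiv p).2 = (e.equiv q).2 := h p q (by rw [hp]) (by rw [hq])
  have hzC : (f.equiv z).1 = (f.equiv x).1 :=
    e.layer_box f.swap ht hc (p := x) (q := p) (congrArg Prod.fst hp).symm
      (by rw [hz]) (by rw [hz])
  have hwC : (f.equiv w).1 = (f.equiv y).1 :=
    e.layer_box f.swap ht hc (p := y) (q := q) (congrArg Prod.fst hq).symm
      (by rw [hw]) (by rw [hw])
  have e1 := e.chainDist_prod hc z w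
  have f1 := f.chainDist_prod hc z w
  have e2 := e.chainDist_prod hc x y
  have f2 := f.chainDist_prod hc x y
  rw [hz, hw, hpq, chainDist_self e.refl_right] at e1
  rw [hzC, hwC] at f1
  rw [hxy, chainDist_self f.refl_right] at f2
  have n1 := chainDist_nonneg f.refl_right (f.equiv z).2 (f.equiv w).2
  have n2 := chainDist_nonneg e.refl_right (e.equiv x).2 (e.equiv y).2
  exact e.eq_of_chainDist_right_eq_zero ht hc (by simp only at e1; linarith)

/-- A layer that is constant in the first factor of another factorization separates no two points
that agree in the second factor. -/
theorem eq_of_layer_constant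
    (h : ∀ x y, (f.equiv x).2 = (f.equiv y).2 → (e.equiv x).1 = (e.equiv y).1) {v w : X}
    (hvw : (e.equiv v).2 = (e.equiv w).2) : (f.equiv v).1 = (f.equiv w).1 := by
  -- With this $u$, $d(v,w)=d_A(v,w)\le d(u,w)=d_D(v,w)=d(v,w)-d_C(v,w)$.
  obtain ⟨u, hu⟩ : ∃ u, f.equiv u = ((f.equiv w).1, (f.equiv v).2) := f.equiv.surjective _
  have huv : (e.equiv u).1 = (e.equiv v).1 := h u v (by rw [hu])
  have e1 := e.chainDist_prod hc v w
  have f1 := f.chainDist_prod hc v w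
  have e2 := e.chainDist_prod hc u w
  have f2 := f.chainDist_prod hc u w
  rw [hvw, chainDist_self e.refl_right] at e1
  rw [huv] at e2
  rw [hu, chainDist_self f.refl_left] at f2
  have n1 := chainDist_nonneg e.refl_right (e.equiv u).2 (e.equiv w).2
  have n2 := chainDist_nonneg f.refl_left (f.equiv v).1 (f.equiv w).1
  exact f.swap.eq_of_chainDist_right_eq_zero ht hc
    (show chainDist RC (f.equiv v).1 (f.equiv w).1 = 0 by simp only at f2; linarith)

end Box

/-! ### Layers of a prime factor. -/

section Prime

variable {X A B D : Type*} {C : Type u} {R : X → X → Prop} {RA : A → A → Prop}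
  {RB : B → B → Prop} {RD : D → D → Prop} {K : SimpleGraph C}
  [Finite X] [Finite A] [Finite B] [Finite C] [Finite D]
  (e : RelFactorization R RA RB) (f : RelFactorization R (reflAdj K) RD)
  (ht : ∀ x y, relNbhd R x = relNbhd R y → x = y) (hc : ChainConnected R)

include ht hc

/-- A layer of a graph factor is the strong product of its intersections with two layers of
another factorization. -/
theorem layer_iso_strongProd (x₀ : X) :
    Nonempty (K ≃g strongProd
      (K.induce {c | (e.equiv (f.equiv.symm (c, (f.equiv x₀).2))).2 = (e.equiv x₀).2})
      (K.induce {c | (e.equiv (f.equiv.symm (c, (f.equiv x₀).2))).1 = (e.equiv x₀).1})) := by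
  set d := (f.equiv x₀).2 with hd
  let g : C → X := fun c => f.equiv.symm (c, d)
  have hg : ∀ c, f.equiv (g c) = (c, d) := fun c => by simp [g]
  have hg' : ∀ x, (f.equiv x).2 = d → g (f.equiv x).1 = x := fun x hx => by simp [g, ← hx]
  -- Corners of pairs from the layer stay in it by `layer_box`; mixing with $x_0$ gives the two
  -- projections, mixing these recovers the point.
  let mix : X → X → X := fun x y => e.equiv.symm ((e.equiv x).1, (e.equiv y).2)
  have hmix : ∀ x y, e.equiv (mix x y) = ((e.equiv x).1, (e.equiv y).2) := fun x y => by
    simp [mix]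
  have hbox : ∀ x y, (f.equiv x).2 = d → (f.equiv y).2 = d → (f.equiv (mix x y)).2 = d :=
    fun x y hx hy => (e.layer_box f ht hc (p := x) (q := y) (hx.trans hy.symm)
      (by rw [hmix]) (by rw [hmix])).trans hx
  have hgd : ∀ c, (f.equiv (g c)).2 = d := fun c => by rw [hg]
  have hK : ∀ c c', reflAdj K c c' ↔ R (g c) (g c') := fun c c' => by
    rw [f.rel_iff, hg, hg]
    exact ⟨fun h => ⟨h, f.refl_right _⟩, And.left⟩
  have hgm : ∀ x y, (f.equiv x).2 = d → (f.equiv y).2 = d →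
      g (f.equiv (mix x y)).1 = mix x y := fun x y hx hy => hg' _ (hbox x y hx hy)
  let E : C ≃ {c | (e.equiv (g c)).2 = (e.equiv x₀).2} × {c | (e.equiv (g c)).1 = (e.equiv x₀).1} :=
    { toFun := fun c => (⟨(f.equiv (mix (g c) x₀)).1, by
          simp only [Set.mem_ofPred_eq]; rw [hgm _ _ (hgd c) rfl, hmix]⟩,
        ⟨(f.equiv (mix x₀ (g c))).1, by
          simp only [Set.mem_ofPred_eq]; rw [hgm _ _ rfl (hgd c), hmix]⟩)
      invFun := fun c => (f.equiv (mix (g c.1) (g c.2))).1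
      left_inv := fun c => by
        simp only
        rw [hgm _ _ (hgd c) rfl, hgm _ _ rfl (hgd c)]
        have : mix (mix (g c) x₀) (mix x₀ (g c)) = g c := by simp [mix]
        rw [this, hg]
      right_inv := fun ⟨⟨a, ha⟩, ⟨b, hb⟩⟩ => by
        simp only [Set.mem_ofPred_eq] at ha hb
        have h1 : mix (mix (g a) (g b)) x₀ = g a := by
          apply e.equiv.injective; rw [hmix, hmix, ← ha]
        have h2 : mix x₀ (mix (g a) (g b)) = g b := by
          apply e.equiv.injective; rw [hmix, hmix, ← hb]
        ext <;> simp only <;> rw [hgm _ _ (hgd a) (hgd b)]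
        · rw [h1, hg]
        · rw [h2, hg] }
  have hred : ∀ (s : Set C) (a b : s), reflAdj (K.induce s) a b ↔ reflAdj K a b := fun s a b => by
    simp [reflAdj, Subtype.ext_iff]
  refine ⟨⟨E, fun {c c'} => ?_⟩⟩
  rw [strongProd_adj_iff, adj_iff_reflAdj, E.injective.ne_iff, hred, hred, hK, hK, hK]
  simp only [E, Equiv.coe_fn_mk]
  rw [hgm _ _ (hgd c) rfl, hgm _ _ rfl (hgd c), hgm _ _ (hgd c') rfl, hgm _ _ rfl (hgd c'),
    e.rel_iff, e.rel_iff, e.rel_iff (g c)]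
  simp only [hmix]
  refine and_congr_right fun _ => ?_
  exact ⟨fun h => ⟨h.1.1, h.2.2⟩, fun h => ⟨⟨h.1, e.refl_right _⟩, ⟨e.refl_left _, h.2⟩⟩⟩

/-- A layer is constant in the first factor of another factorization if its intersection with
a layer of that factor has only one vertex. -/
theorem layer_constant_of_subsingleton {RC : C → C → Prop} (f : RelFactorization R RC RD) {x₀ : X}
    (hs : Subsingleton
      {c | (e.equiv (f.equiv.symm (c, (f.equiv x₀).2))).2 = (e.equiv x₀).2})
    {x : X} (hx : (f.equiv x).2 = (f.equiv x₀).2) : (e.equiv x).1 = (e.equiv x₀).1 := by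
  -- This corner lies in the one-point section, so it is $x_0$.
  obtain ⟨z, hz⟩ : ∃ z, e.equiv z = ((e.equiv x).1, (e.equiv x₀).2) := e.equiv.surjective _
  have hzd : (f.equiv z).2 = (f.equiv x₀).2 :=
    (e.layer_box f ht hc (p := x) (q := x₀) hx (by rw [hz]) (by rw [hz])).trans hx
  have hz' : f.equiv.symm ((f.equiv z).1, (f.equiv x₀).2) = z := by simp [← hzd]
  have := congrArg Subtype.val (hs.elim
    ⟨(f.equiv z).1, by simp only [Set.mem_ofPred_eq]; rw [hz', hz]⟩ ⟨(f.equiv x₀).1, by simp⟩)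
  have hzx : z = x₀ := f.equiv.injective (Prod.ext this hzd)
  rw [← hzx, hz]

/-- The layers of a prime factor lie in the layers of one of the factors of any factorization. -/
theorem layer_constant_of_prime (hK : IsPrime K) :
    (∀ x y, (f.equiv x).2 = (f.equiv y).2 → (e.equiv x).1 = (e.equiv y).1) ∨
    (∀ x y, (f.equiv x).2 = (f.equiv y).2 → (e.equiv x).2 = (e.equiv y).2) := by
  rcases isEmpty_or_nonempty X with hX | ⟨⟨x₀⟩⟩
  · exact Or.inl fun x => hX.elim x
  rcases hK _ _ _ _ (e.layer_iso_strongProd f ht hc x₀) with h | h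
  · left
    exact fun x y hxy => e.swap.layer_constant_of_layer_constant f ht hc
      (fun x y hx hy => (e.layer_constant_of_subsingleton ht hc f h.subsingleton hx).trans
        (e.layer_constant_of_subsingleton ht hc f h.subsingleton hy).symm) hxy
  · right
    exact fun x y hxy => e.layer_constant_of_layer_constant f ht hc
      (fun x y hx hy =>
        (e.swap.layer_constant_of_subsingleton ht hc f h.subsingleton hx).trans
          (e.swap.layer_constant_of_subsingleton ht hc f h.subsingleton hy).symm) hxy

/-- If two points agree in the second factor of a factorization and differ in a prime factor, then
the layers of the prime factor are constant in the second factor. -/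
theorem layer_constant_of_ne (hK : IsPrime K) {v w : X} (hvw : (e.equiv v).2 = (e.equiv w).2)
    (hne : (f.equiv v).1 ≠ (f.equiv w).1) {x y : X} (hxy : (f.equiv x).2 = (f.equiv y).2) :
    (e.equiv x).2 = (e.equiv y).2 :=
  (e.layer_constant_of_prime f ht hc hK).elim
    (fun h => absurd (e.eq_of_layer_constant f ht hc h hvw) hne) fun h => h x y hxy

end Prime

end RelFactorization

/-! ### Factorizations that split off a coordinate. -/

section Pi

variable {ι X : Type*} {V : ι → Type*}

/-- The factorization of a product of relations that splits off one coordinate. -/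
def RelFactorization.piSplitAt [DecidableEq ι] {R : X → X → Prop} (r : ∀ i, V i → V i → Prop)
    (hr : ∀ i a, r i a a) (g : X ≃ ∀ i, V i) (h : ∀ x y, R x y ↔ ∀ i, r i (g x i) (g y i))
    (l : ι) : RelFactorization R (r l)
      (fun a b : ∀ j : {j // j ≠ l}, V j => ∀ j : {j // j ≠ l}, r j (a j) (b j)) where
  equiv := g.trans (Equiv.piSplitAt l V)
  refl_left := hr l
  refl_right := fun _ _ => hr _ _
  rel_iff x y := (h x y).trans
    ⟨fun h => ⟨h l, fun j => h j⟩, fun h i => by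
      by_cases hi : i = l
      · subst hi; exact h.1
      · exact h.2 ⟨i, hi⟩⟩

theorem reflAdj_strongPi {G : ∀ i, SimpleGraph (V i)} {x y : ∀ i, V i} :
    reflAdj (strongPi G) x y ↔ ∀ i, reflAdj (G i) (x i) (y i) := by
  constructor
  · rintro (rfl | h) i
    · exact Or.inl rfl
    · exact h.2 i
  · intro h
    by_cases hxy : x = y
    · exact Or.inl hxy
    · exact Or.inr ⟨hxy, h⟩

variable {G : ∀ i, SimpleGraph (V i)}

/-- The vertices of a subproduct are the vectors of vertices of its factors. -/
def subproductEquiv (A : ∀ i, (G i).Subgraph) :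
    (subproduct A).verts ≃ ∀ i, (A i).verts where
  toFun x i := ⟨x.1 i, x.2 i⟩
  invFun y := ⟨fun i => (y i).1, fun i => (y i).2⟩
  left_inv _ := rfl
  right_inv _ := rfl

theorem reflAdj_subproduct (A : ∀ i, (G i).Subgraph) (x y : (subproduct A).verts) :
    reflAdj (subproduct A).coe x y ↔
      ∀ i, reflAdj (A i).coe (subproductEquiv A x i) (subproductEquiv A y i) := by
  constructor
  · rintro (rfl | h) i
    · exact Or.inl rfl
    · exact (h.2 i).imp (fun h => Subtype.ext h.1) id
  · intro h
    by_cases hxy : x = y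
    · exact Or.inl hxy
    · exact Or.inr ⟨fun h => hxy (Subtype.ext h), fun i =>
        (h i).imp (fun h => ⟨congrArg Subtype.val h, x.2 i⟩) id⟩

end Pi

theorem reflAdj_iso {V W : Type*} {G : SimpleGraph V} {H : SimpleGraph W} (φ : G ≃g H) {x y : V} :
    reflAdj H (φ x) (φ y) ↔ reflAdj G x y :=
  or_congr φ.injective.eq_iff φ.map_adj_iff

theorem relNbhd_reflAdj {V : Type*} (G : SimpleGraph V) (x : V) :
    relNbhd (reflAdj G) x = closedNeighborSet G x :=
  Set.ext fun _ => or_congr_left eq_comm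

theorem chainConnected_of_connected {V : Type*} {G : SimpleGraph V} (h : G.Connected) :
    ChainConnected (reflAdj G) := fun x y => by
  obtain ⟨p⟩ := h.preconnected x y
  induction p with
  | nil => exact ⟨0, .nil _⟩
  | cons hxy _ ih =>
    obtain ⟨r, hr⟩ := ih
    exact ⟨_, .cons (Or.inr hxy) hr⟩

/-! ### Prime coordinates against ambient coordinates. -/

section Layers

variable {ι κ : Type*} [Finite ι] [Finite κ] {V : ι → Type*} {W : κ → Type u}
  [∀ l, Finite (V l)] [∀ i, Finite (W i)] {G : ∀ l, SimpleGraph (V l)}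
  {H : (strongPi G).Subgraph} {K : ∀ i, SimpleGraph (W i)}

/-- If two vertices of a thin subproduct differ only in the coordinate `l` of the ambient product,
then changing one of the prime coordinates in which they differ only affects the coordinate `l`. -/
theorem eq_of_eq_off_prime_coordinate (hHsub : IsSubproduct H) (hHconn : H.coe.Connected)
    (hHthin : IsThin H.coe) (hKprime : ∀ i, IsPrime (K i)) (φ : H.coe ≃g strongPi K) {v w : H.verts}
    {l : ι} (hvw : ∀ j, j ≠ l → v.1 j = w.1 j) {i : κ} (hi : φ v i ≠ φ w i) {x y : H.verts}
    (hxy : ∀ k, k ≠ i → φ x k = φ y k) {j : ι} (hj : j ≠ l) : x.1 j = y.1 j := by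
  classical
  obtain ⟨A, rfl⟩ := hHsub
  let e := RelFactorization.piSplitAt (fun j => reflAdj (A j).coe) (fun _ _ => Or.inl rfl)
    (subproductEquiv A) (reflAdj_subproduct A) l
  let f := RelFactorization.piSplitAt (fun i => reflAdj (K i)) (fun _ _ => Or.inl rfl)
    φ.toEquiv (fun x y => (reflAdj_iso φ).symm.trans reflAdj_strongPi) i
  have key := e.layer_constant_of_ne f
    (fun x y h => hHthin x y (by rwa [relNbhd_reflAdj, relNbhd_reflAdj] at h))
    (chainConnected_of_connected hHconn) (hKprime i) (v := v) (w := w) (x := x) (y := y)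
    (funext fun j => Subtype.ext (hvw j j.2)) hi (funext fun k => hxy k k.2)
  exact congrArg Subtype.val (congrFun key ⟨j, hj⟩)

/-- If two vertices of a thin subproduct differ only in the coordinate `l` of the ambient product,
then changing prime coordinates in which they differ only affects the coordinate `l`. -/
theorem eq_of_eq_off_prime_coordinates (hHsub : IsSubproduct H) (hHconn : H.coe.Connected)
    (hHthin : IsThin H.coe) (hKprime : ∀ i, IsPrime (K i)) (φ : H.coe ≃g strongPi K) {v w : H.verts}
    {l : ι} (hvw : ∀ j, j ≠ l → v.1 j = w.1 j) {x y : H.verts}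
    (hxy : ∀ k, φ v k = φ w k → φ x k = φ y k) {j : ι} (hj : j ≠ l) : x.1 j = y.1 j := by
  classical
  have := Fintype.ofFinite κ
  -- Pass from $x$ to $y$ one prime coordinate at a time; where $v,w$ agree, nothing changes.
  have key : ∀ s : Finset κ, (φ.symm (s.piecewise (φ y) (φ x))).1 j = x.1 j := fun s => by
    induction s using Finset.induction_on with
    | empty => simp
    | insert i s _ ih =>
      rw [← ih]
      by_cases hi : φ v i = φ w i
      · refine congrArg (fun z => (φ.symm z).1 j) (funext fun k => ?_)
        by_cases hk : k = i
        · subst hk; by_cases hks : k ∈ s <;> simp [hks, hxy k hi]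
        · simp [hk]
      · refine eq_of_eq_off_prime_coordinate hHsub hHconn hHthin hKprime φ hvw hi
          (fun k hk => ?_) hj
        simp [Finset.piecewise_insert, hk]
  simpa using (key Finset.univ).symm

end Layers

end StrongProduct

/-! ### Embedding the $J$-layers. -/

theorem mainTheorem3 {n m : ℕ} {V : Fin n → Type*} {W : Fin m → Type*}
    [∀ l, Finite (V l)] [∀ i, Finite (W i)]
    -- the graph `G`, the strong product of the connected prime graphs `G l`
    (G : ∀ l, SimpleGraph (V l))
    (hGprime : ∀ l, StrongProduct.IsPrime (G l))
    (hGconn : (StrongProduct.strongPi G).Connected)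
    (hGthin : StrongProduct.IsThin (StrongProduct.strongPi G))
    -- the connected thin subproduct `H`, with its prime factors `K i` and its coordinates `φ`
    (H : (StrongProduct.strongPi G).Subgraph)
    (hHsub : StrongProduct.IsSubproduct H)
    (hHconn : H.coe.Connected)
    (hHthin : StrongProduct.IsThin H.coe)
    (K : ∀ i, SimpleGraph (W i))
    (hKprime : ∀ i, StrongProduct.IsPrime (K i))
    (φ : H.coe ≃g StrongProduct.strongPi K)
    -- an edge of `H` that is non-Cartesian in `H` and Cartesian in `G`
    (v w : H.verts)
    (hvw : H.coe.Adj v w)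
    (hvwH : ¬ StrongProduct.IsCartesianEdge K (φ v) (φ w))
    (hvwG : StrongProduct.IsCartesianEdge G v.1 w.1)
    (J : Set (Fin m)) (hJ : J = {i | φ v i ≠ φ w i}) :
    ∃ l : Fin n,
      -- the factor formed by the `K i` with `i ∈ J` is isomorphic to a subgraph of `G l` ...
      (StrongProduct.strongPi fun i : J => K i).IsContained (G l) ∧
      -- ... and, inside `G`, each of its layers in `H` is a subgraph of a `G l`-layer
      ∀ u : H.verts,
        ((StrongProduct.layer K J (φ u)).map φ.symm.toHom).map H.hom ≤
          StrongProduct.layer G {l} u.1 := by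
  classical
  obtain ⟨l, hl, hlu⟩ := hvwG.2
  have hvwl : ∀ j, j ≠ l → v.1 j = w.1 j := fun j hj => by
    by_contra h
    exact hj (hlu j h)
  have key : ∀ {x y : H.verts}, (∀ k, k ∉ J → φ x k = φ y k) → ∀ j, j ≠ l → x.1 j = y.1 j :=
    fun hxy j hj => StrongProduct.eq_of_eq_off_prime_coordinates hHsub hHconn hHthin hKprime φ hvwl
      (fun k hk => hxy k (by rw [hJ]; exact not_not.2 hk)) hj
  refine ⟨l, ?_, fun u => ?_⟩
  -- The layer through $v$ is used; any other base vertex would serve to fill the coordinates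
  -- outside $J$.
  · let ext : (∀ i : J, W i) → ∀ i, W i := fun t i => if h : i ∈ J then t ⟨i, h⟩ else φ v i
    have hext : ∀ t (i : J), ext t i = t i := fun t i => by simp [ext]
    have hoff : ∀ t t' k, k ∉ J → ext t k = ext t' k := fun t t' k hk => by simp [ext, hk]
    have hl : ∀ t t' j, j ≠ l → (φ.symm (ext t)).1 j = (φ.symm (ext t')).1 j := fun t t' =>
      key fun k hk => by simpa using hoff t t' k hk
    have hinj : Function.Injective fun t => (φ.symm (ext t)).1 l := fun t t' h => by
      have h1 : φ.symm (ext t) = φ.symm (ext t') := Subtype.ext (funext fun j => by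
        by_cases hj : j = l
        · subst hj; exact h
        · exact hl t t' j hj)
      have h2 := φ.symm.injective h1
      funext i
      rw [← hext t, ← hext t', h2]
    refine ⟨⟨⟨fun t => (φ.symm (ext t)).1 l, fun {t t'} h => ?_⟩, hinj⟩⟩
    have hadj : (StrongProduct.strongPi K).Adj (ext t) (ext t') := by
      refine ⟨fun h' => h.1 (funext fun i => by rw [← hext t, ← hext t', h']), fun i => ?_⟩
      by_cases hi : i ∈ J
      · simpa [ext, hi] using h.2 ⟨i, hi⟩
      · exact Or.inl (hoff t t' i hi)
    have hadjG : (StrongProduct.strongPi G).Adj (φ.symm (ext t)).1 (φ.symm (ext t')).1 :=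
      H.hom.map_adj (φ.symm.map_adj_iff.2 hadj)
    -- Adjacency in $G$ also allows equal $l$-coordinates; injectivity rules that out.
    exact (hadjG.2 l).resolve_left (hinj.ne h.1)
  · have hmem : ∀ z ∈ (StrongProduct.layer K J (φ u)).verts,
        (φ.symm z).1 ∈ (StrongProduct.layer G {l} u.1).verts := fun z hz j hj =>
      key (fun k hk => by simpa using hz k hk) j hj
    constructor
    · rintro _ ⟨_, ⟨z, hz, rfl⟩, rfl⟩
      exact hmem z hz
    · rintro _ _ ⟨_, _, ⟨z, z', h, rfl, rfl⟩, rfl, rfl⟩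
      exact ⟨hmem z h.1, hmem z' h.2.1, H.hom.map_adj (φ.symm.map_adj_iff.2 h.2.2)⟩
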